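/- Let $S$ be a finite set, $\mathbb A=S^{\mathbb N}$ the space of one-sided sequences $x=(x_0,x_1,\dots)$, $\sigma$ the left shift, $\theta\in(0,1)$ and $d(x,y)=\theta^{\inf\{n\ge 0:\,x_n\ne y_n\}}$ (with $d(x,x)=0$). For a function $\psi:\mathbb A\to\mathbb R$ write $\|\psi\|$ for a constant $\ge 1$ such that $\sup|\psi|\le\|\psi\|$ and $|\psi(x)-\psi(y)|\le\|\psi\|\,d(x,y)$ for all $x,y$. Let $\phi_p:\mathbb A\to\mathbb R$ be a Lipschitz potential, normalized by $\sum_{s\in S}e^{\phi_p(sx)}=1$ for all $x$, with transfer operator $(Pf)(x)=\sum_{s\in S}e^{\phi_p(sx)}f(sx)$, and let $\mu$ be its equilibrium state: a $\sigma$-invariant probability measure with $\int Pf\,d\mu=\int f\,d\mu$ for all bounded measurable $f$. Let $\phi:\mathbb A\to\mathbb R$ be a Lipschitz observable with $\int\phi\,d\mu=0$, and $S_n=\sum_{0\le i\le n-1}\phi\circ\sigma^i$. Put $$a=1-\exp\Big(-\frac{\|\phi_p\|}{1-\theta}\Big),\qquad \epsilon\in(0,\min\{1-a,1-\theta\}),\qquad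 U=\frac{\log(1-\epsilon)}{\log[\theta\epsilon(1-\epsilon-\theta)]-\log(2\|\phi_p\|)},$$ $$z_0\in\Big(1,\min\Big\{\Big(\frac{a+\epsilon/2}{a}\Big)^{U},\frac{\theta+\epsilon}{\theta},\frac{1-\epsilon}{\theta},e^2\Big\}\Big).$$ Let $\delta\in(0,1/2)$ and $$N_{x,\delta}=\sum_{N\ge 0}\mathbf 1_{\bigcup_{n\ge N}\{|S_n|\ge n^{1/2+\delta}\}}(x)\in[0,\infty].$$ Then $N_{x,\delta}$ is measurable in $x$ and, for $\mu$-a.e. $x$, $N_{x,\delta}<\infty$ and $$\Big|\frac{S_n(x)}{n}\Big|\le n^{-(1/2-\delta)}\qquad\text{for all } n\ge N_{x,\delta}.$$ Moreover $$\|N_{x,\delta}\|_{L^1(\mu)}\le 2\exp\Big(\frac{(1-z_0^{-1/2})(1-a-\epsilon)\log\sqrt{z_0}}{36\,\|\phi\|\,z_0^{1/2}}\Big)\sum_{m\ge1}m\exp\Big(-\frac{m^{2\delta}(1-z_0^{-1/2})^2(1-a-\epsilon)^2(\log\sqrt{z_0})^2}{72\,\|\phi\|^2}\Big),$$ and the series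 converges. -/

import Mathlib

open MeasureTheory Real
open scoped ENNReal

noncomputable section

namespace MarkovShift

variable {S : Type*}

/-- The left shift on the space of one-sided sequences `ℕ → S`. -/
def shift (x : ℕ → S) : ℕ → S := fun n => x (n + 1)

/-- The sequence `a x = (a, x₀, x₁, …)`. -/
def cons (a : S) (x : ℕ → S) : ℕ → S
  | 0 => a
  | n + 1 => x n

/-- The distance `d(x, y) = θ ^ inf {n ≥ 0 : x n ≠ y n}`, with `d(x, x) = 0`. -/
def shiftDist (θ : ℝ) (x y : ℕ → S) : ℝ :=
  open Classical in if x = y then 0 else θ ^ sInf {n : ℕ | x n ≠ y n}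

/-- `L` is an admissible value of `‖φ‖`: `L ≥ 1` bounds both the supremum norm and the
Lipschitz constant of `φ` for the distance `shiftDist θ`. -/
structure HasLipNorm (θ L : ℝ) (φ : (ℕ → S) → ℝ) : Prop where
  one_le : 1 ≤ L
  abs_le : ∀ x, |φ x| ≤ L
  lipschitz : ∀ x y, |φ x - φ y| ≤ L * shiftDist θ x y

/-- The potential `φp` is normalized: `∑ₐ exp (φp (a x)) = 1` for every `x`. -/
def IsNormalized [Fintype S] (φp : (ℕ → S) → ℝ) : Prop :=
  ∀ x, ∑ a : S, exp (φp (cons a x)) = 1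

/-- The transfer operator `(P f)(x) = ∑ₐ exp (φp (a x)) f (a x)`. -/
def transfer [Fintype S] (φp f : (ℕ → S) → ℝ) (x : ℕ → S) : ℝ :=
  ∑ a : S, exp (φp (cons a x)) * f (cons a x)

/-- Equilibrium state of a normalized potential: a shift-invariant probability measure that is
fixed by the dual of the transfer operator, i.e. `∫ P f dμ = ∫ f dμ`. -/
structure IsEquilibriumState [Fintype S] [MeasurableSpace S] (φp : (ℕ → S) → ℝ)
    (μ : Measure (ℕ → S)) : Prop where
  prob : IsProbabilityMeasure μ
  invariant : μ.map shift = μ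
  dual : ∀ f : (ℕ → S) → ℝ, Measurable f → (∃ C : ℝ, ∀ x, |f x| ≤ C) →
    ∫ x, transfer φp f x ∂μ = ∫ x, f x ∂μ

/-- `a = 1 - exp (-‖φp‖ (1 - θ)⁻¹)`, where `Lp` stands for `‖φp‖`. -/
def aConst (θ Lp : ℝ) : ℝ := 1 - exp (-(Lp * (1 - θ)⁻¹))

/-- `U = log (1 - ε) / (log (θ ε (1 - ε - θ)) - log (2 ‖φp‖))`. -/
def uConst (θ Lp ε : ℝ) : ℝ :=
  log (1 - ε) / (log (θ * ε * (1 - ε - θ)) - log (2 * Lp))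

/-- `N_{x,δ} = ∑_{N ≥ 0} 1_{⋃_{n ≥ N} {|S_n| ≥ n^{1/2+δ}}}(x)`, with values in `[0, ∞]`, where
`S_n(x) = ∑_{i ≤ n-1} φ (σ^i x)` is the Birkhoff sum. -/
def threshold (φ : (ℕ → S) → ℝ) (δ : ℝ) (x : ℕ → S) : ℝ≥0∞ :=
  ∑' N : ℕ, Set.indicator
    (⋃ n ≥ N, {y : ℕ → S | (n : ℝ) ^ (1 / 2 + δ) ≤ |birkhoffSum shift φ n y|})
    (fun _ => (1 : ℝ≥0∞)) x

end MarkovShift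

end

open MeasureTheory Real
open scoped ENNReal

noncomputable section

namespace MarkovShift

/-! ### Oscillation of the sums of iterates of the transfer operator. -/

section Transfer

variable {S : Type*} {θ L Lp : ℝ} {φ φp : (ℕ → S) → ℝ}

/-! Write `P` for the transfer operator and `g_k = P φ + … + P ^ k φ`, so `g_{k+1} = P (φ + g_k)`.
Normalization makes the weights `exp (φp (a x))` a probability vector in `a`, so Hoeffding's lemma
gives `P (exp (t (φ + g_k))) ≤ exp (t g_{k+1} + R² t² / 8)` whenever `φ + g_k` has oscillation at
most `R`. By duality, each application of `P` trades one term of the Birkhoff sum for one such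
factor; after `n` applications `∫ exp (t S_n) ≤ exp (n R² t² / 8) ∫ exp (t g_n)`. As `g_n` has mean
zero and oscillation at most `R`, `S_n` is sub-Gaussian with variance proxy `(n + 1) R² / 4`
(`hasSubgaussianMGF_birkhoffSum`).

An `R` independent of `k`, namely `oscBound`, comes from a coupling estimate (`transferSum_sub_le`);
no spectral gap is needed. The Chernoff bound then controls each deviation set. Since `∫ N_{x,δ} ≤ 1
+ ∑ n μ(|S_n| ≥ n ^ (1/2 + δ))`, it remains to compare `R` with the constants of the statement
(`rate_mul_oscBound_le`). -/

lemma shiftDist_le_pow (hθ : θ ∈ Set.Ioo (0 : ℝ) 1) {n : ℕ} {x y : ℕ → S}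
    (h : ∀ i < n, x i = y i) : shiftDist θ x y ≤ θ ^ n := by
  unfold shiftDist
  split_ifs with hxy
  · exact (pow_pos hθ.1 n).le
  · apply pow_le_pow_of_le_one hθ.1.le hθ.2.le
    have hne : {n : ℕ | x n ≠ y n}.Nonempty := Function.ne_iff.mp hxy
    by_contra! hlt
    exact (Nat.sInf_mem hne) (h _ hlt)

lemma cons_agree {n : ℕ} {x y : ℕ → S} (h : ∀ i < n, x i = y i) (a : S) :
    ∀ i < n + 1, cons a x i = cons a y i := by
  rintro (_ | i) hi
  · rfl
  · exact h i (by omega)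

lemma HasLipNorm.sub_le_pow (hφ : HasLipNorm θ L φ) (hθ : θ ∈ Set.Ioo (0 : ℝ) 1) {n : ℕ}
    {x y : ℕ → S} (h : ∀ i < n, x i = y i) : φ x - φ y ≤ L * θ ^ n :=
  (le_abs_self _).trans <| (hφ.lipschitz x y).trans <|
    mul_le_mul_of_nonneg_left (shiftDist_le_pow hθ h) (zero_le_one.trans hφ.one_le)

lemma exp_mul_weight_le (hφp : HasLipNorm θ Lp φp) (hθ : θ ∈ Set.Ioo (0 : ℝ) 1) {n : ℕ}
    {x y : ℕ → S} (h : ∀ i < n, x i = y i) (a : S) :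
    exp (-(Lp * θ ^ n)) * exp (φp (cons a x)) ≤ exp (φp (cons a y)) := by
  rw [← exp_add, exp_le_exp]
  have := hφp.sub_le_pow hθ (fun i hi => cons_agree h a i (hi.trans n.lt_succ_self))
  linarith

variable [Fintype S]

/-- A coupling: the weights at `y` dominate `s = exp (-(Lp θ ^ n))` times those at `x`. On this
common mass the same symbol is prepended to both points, which then agree one step further (bound
`B`); on the remaining mass `1 - s` only the global oscillation `A` is available. -/
lemma transfer_sub_le (hφp : HasLipNorm θ Lp φp) (hnorm : IsNormalized φp)
    (hθ : θ ∈ Set.Ioo (0 : ℝ) 1) {f : (ℕ → S) → ℝ} {A B : ℝ} {n : ℕ}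
    (hA : ∀ x y, f x - f y ≤ A)
    (hB : ∀ x y, (∀ i < n + 1, x i = y i) → f x - f y ≤ B)
    {x y : ℕ → S} (h : ∀ i < n, x i = y i) :
    transfer φp f x - transfer φp f y
      ≤ exp (-(Lp * θ ^ n)) * B + (1 - exp (-(Lp * θ ^ n))) * A := by
  set s := exp (-(Lp * θ ^ n)) with hs
  set p : S → ℝ := fun a => exp (φp (cons a x)) with hp
  set r : S → ℝ := fun a => exp (φp (cons a y)) - s * p a with hr
  have hp0 : ∀ a, 0 ≤ p a := fun a => (exp_pos _).le
  have hr0 : ∀ a, 0 ≤ r a := fun a => sub_nonneg.2 (exp_mul_weight_le hφp hθ h a)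
  have hp1 : ∑ a, p a = 1 := hnorm x
  have hr1 : ∑ a, r a = 1 - s := by
    simp only [hr, Finset.sum_sub_distrib, ← Finset.mul_sum, hp1, hnorm y, mul_one]
  set M := ∑ a, p a * f (cons a x) with hM
  have hy : transfer φp f y = s * ∑ a, p a * f (cons a y) + ∑ a, r a * f (cons a y) := by
    simp only [transfer, hr, Finset.mul_sum, ← Finset.sum_add_distrib]
    exact Finset.sum_congr rfl fun a _ => by ring
  have hMb : ∀ b, M - A ≤ f (cons b y) := fun b => by
    have : M ≤ ∑ a, p a * (f (cons b y) + A) :=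
      Finset.sum_le_sum fun a _ => mul_le_mul_of_nonneg_left
        (by linarith [hA (cons a x) (cons b y)]) (hp0 a)
    rw [← Finset.sum_mul, hp1] at this
    linarith
  have h1 : (1 - s) * (M - A) ≤ ∑ a, r a * f (cons a y) := by
    rw [← hr1, Finset.sum_mul]
    exact Finset.sum_le_sum fun a _ => mul_le_mul_of_nonneg_left (hMb a) (hr0 a)
  have h2 : M - ∑ a, p a * f (cons a y) ≤ B := by
    rw [hM, ← Finset.sum_sub_distrib]
    calc ∑ a, (p a * f (cons a x) - p a * f (cons a y)) ≤ ∑ a, p a * B :=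
          Finset.sum_le_sum fun a _ => by
            rw [← mul_sub]
            exact mul_le_mul_of_nonneg_left (hB _ _ (cons_agree h a)) (hp0 a)
      _ = B := by rw [← Finset.sum_mul, hp1, one_mul]
  have h3 := mul_le_mul_of_nonneg_left h2 (exp_pos (-(Lp * θ ^ n))).le
  rw [← hs] at h3
  have hx : transfer φp f x = M := rfl
  rw [hx, hy]
  linarith

/-- The sums `∑_{1 ≤ j ≤ k} P ^ j φ`. -/
def transferSum (φp φ : (ℕ → S) → ℝ) : ℕ → (ℕ → S) → ℝ
  | 0 => 0
  | k + 1 => transfer φp (φ + transferSum φp φ k)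

/-- A uniform bound for the oscillation of the sums `∑_{0 ≤ j ≤ k} P ^ j φ`. -/
def oscBound (θ L Lp : ℝ) : ℝ := L / (1 - θ) * exp (Lp / (1 - θ))

/-- A lower bound for the gain in the oscillation of `∑_{0 ≤ j ≤ k} P ^ j φ` on cylinders of
length `n`. -/
def oscGain (θ L Lp : ℝ) (n : ℕ) : ℝ :=
  L * (1 - θ ^ n) / (1 - θ) * exp (Lp * (1 - θ ^ n) / (1 - θ))

lemma oscGain_zero : oscGain θ L Lp 0 = 0 := by simp [oscGain]

lemma oscGain_nonneg (hθ : θ ∈ Set.Ioo (0 : ℝ) 1) (hL : 0 ≤ L) (n : ℕ) :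
    0 ≤ oscGain θ L Lp n := by
  have h1 : 0 < 1 - θ := sub_pos.2 hθ.2
  have h2 : 0 ≤ 1 - θ ^ n := sub_nonneg.2 (pow_le_one₀ hθ.1.le hθ.2.le)
  unfold oscGain
  positivity

lemma oscGain_le (hθ : θ ∈ Set.Ioo (0 : ℝ) 1) (hL : 0 ≤ L) (hLp : 0 ≤ Lp) (n : ℕ) :
    oscGain θ L Lp n ≤ oscBound θ L Lp := by
  have h1 : 0 < 1 - θ := sub_pos.2 hθ.2
  have h2 : 1 - θ ^ n ≤ 1 := sub_le_self _ (pow_pos hθ.1 n).le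
  unfold oscGain oscBound
  gcongr
  · exact mul_le_of_le_one_right hL h2
  · exact mul_le_of_le_one_right hLp h2

/-- The recursion for which `oscGain` is designed: `exp (-(Lp θ ^ n))` cancels the last summand of
the geometric sum in the exponent, and the last summand of the prefactor pays for the variation `L θ
^ n` of `φ`. -/
lemma oscGain_succ (hθ : θ ∈ Set.Ioo (0 : ℝ) 1) (hL : 0 ≤ L) (hLp : 0 ≤ Lp) (n : ℕ) :
    oscGain θ L Lp n + L * θ ^ n ≤ exp (-(Lp * θ ^ n)) * oscGain θ L Lp (n + 1) := by
  have h1 : 0 < 1 - θ := sub_pos.2 hθ.2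
  have h2 : 0 ≤ 1 - θ ^ n := sub_nonneg.2 (pow_le_one₀ hθ.1.le hθ.2.le)
  have hE : Lp * (1 - θ ^ (n + 1)) / (1 - θ) = Lp * (1 - θ ^ n) / (1 - θ) + Lp * θ ^ n := by
    field_simp
    ring
  have hF : L * (1 - θ ^ (n + 1)) / (1 - θ) = L * (1 - θ ^ n) / (1 - θ) + L * θ ^ n := by
    field_simp
    ring
  unfold oscGain
  rw [hE, hF, exp_add, mul_comm (exp (-_)), mul_assoc, mul_assoc, ← exp_add (Lp * θ ^ n),
    add_neg_cancel, exp_zero, mul_one, add_mul]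
  refine add_le_add le_rfl ?_
  exact le_mul_of_one_le_right (mul_nonneg hL (pow_nonneg hθ.1.le n)) (one_le_exp (by positivity))

/-- The bound does not depend on `k`, so it reproduces itself: adding `φ` gives oscillation at most
`oscBound - oscGain m` on cylinders of length `m` by `oscGain_succ`, and `transfer_sub_le` restores
the original form. -/
lemma transferSum_sub_le (hφp : HasLipNorm θ Lp φp) (hnorm : IsNormalized φp)
    (hφ : HasLipNorm θ L φ) (hθ : θ ∈ Set.Ioo (0 : ℝ) 1) (k n : ℕ) {x y : ℕ → S}
    (h : ∀ i < n, x i = y i) :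
    transferSum φp φ k x - transferSum φp φ k y ≤
      oscBound θ L Lp - exp (-(Lp * θ ^ n)) * oscGain θ L Lp (n + 1) := by
  have hL : 0 ≤ L := zero_le_one.trans hφ.one_le
  have hLp : 0 ≤ Lp := zero_le_one.trans hφp.one_le
  induction k generalizing n x y with
  | zero =>
    have h1 : exp (-(Lp * θ ^ n)) ≤ 1 :=
      exp_le_one_iff.2 (neg_nonpos.2 (mul_nonneg hLp (pow_nonneg hθ.1.le n)))
    have h2 := mul_le_of_le_one_left (oscGain_nonneg hθ hL (Lp := Lp) (n + 1)) h1
    have h3 := oscGain_le hθ hL hLp (n + 1)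
    simp only [transferSum, Pi.zero_apply, sub_self]
    linarith
  | succ k ih =>
    have key : ∀ (m : ℕ) (x y : ℕ → S), (∀ i < m, x i = y i) →
        (φ + transferSum φp φ k) x - (φ + transferSum φp φ k) y ≤
          oscBound θ L Lp - oscGain θ L Lp m := fun m x y h => by
      have h1 := ih m h
      have h2 := hφ.sub_le_pow hθ h
      have h3 := oscGain_succ hθ hL hLp m
      simp only [Pi.add_apply]
      linarith
    -- The global oscillation is the case `m = 0` of `key`, where the gain vanishes.
    have := transfer_sub_le hφp hnorm hθ (A := oscBound θ L Lp)
      (fun x y => by simpa [oscGain_zero] using key 0 x y (by simp)) (key (n + 1)) h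
    simp only [transferSum]
    linarith

lemma transferSum_osc (hφp : HasLipNorm θ Lp φp) (hnorm : IsNormalized φp)
    (hφ : HasLipNorm θ L φ) (hθ : θ ∈ Set.Ioo (0 : ℝ) 1) (k : ℕ) (x y : ℕ → S) :
    transferSum φp φ k x - transferSum φp φ k y ≤ oscBound θ L Lp ∧
    (φ + transferSum φp φ k) x - (φ + transferSum φp φ k) y ≤ oscBound θ L Lp := by
  have hL : 0 ≤ L := zero_le_one.trans hφ.one_le
  have hLp : 0 ≤ Lp := zero_le_one.trans hφp.one_le
  have h1 := transferSum_sub_le hφp hnorm hφ hθ k 0 (x := x) (y := y) (by simp)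
  have h2 := hφ.sub_le_pow hθ (n := 0) (x := x) (y := y) (by simp)
  have h3 := oscGain_succ hθ hL hLp 0
  rw [oscGain_zero] at h3
  simp only [Pi.add_apply]
  simp only [pow_zero, mul_one] at *
  constructor <;> linarith

end Transfer

end MarkovShift

namespace MarkovShift

open ProbabilityTheory
open scoped NNReal

/-! ### Hoeffding's lemma for functions of bounded oscillation. -/

section Hoeffding

variable {Ω : Type*} [MeasurableSpace Ω]

lemma hasSubgaussianMGF_sub_integral_of_osc_le {μ : Measure Ω} [IsProbabilityMeasure μ]
    {f : Ω → ℝ} (hf : AEMeasurable f μ) {R : ℝ≥0} (hR : ∀ x y, f x - f y ≤ R) :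
    HasSubgaussianMGF (fun x => f x - μ[f]) ((R / 2) ^ 2) μ := by
  obtain ⟨x₀⟩ : Nonempty Ω := nonempty_of_isProbabilityMeasure μ
  have hbdd : BddBelow (Set.range f) := ⟨f x₀ - R, by
    rintro _ ⟨y, rfl⟩
    linarith [hR x₀ y]⟩
  have : Nonempty Ω := ⟨x₀⟩
  have h := hasSubgaussianMGF_of_mem_Icc (a := ⨅ x, f x) (b := (⨅ x, f x) + R) hf <|
    ae_of_all _ fun x => ⟨ciInf_le hbdd x, by
      have : f x - R ≤ ⨅ x, f x := le_ciInf fun y => by linarith [hR x y]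
      linarith⟩
  simpa using h

lemma integral_exp_mul_le {μ : Measure Ω} [IsProbabilityMeasure μ]
    {f : Ω → ℝ} (hf : AEMeasurable f μ) {R : ℝ≥0} (hR : ∀ x y, f x - f y ≤ R) (t : ℝ) :
    ∫ x, exp (t * f x) ∂μ ≤ exp (t * ∫ x, f x ∂μ + (R / 2 : ℝ) ^ 2 * t ^ 2 / 2) := by
  have h := (hasSubgaussianMGF_sub_integral_of_osc_le hf hR).mgf_le t
  have h2 : ∫ x, exp (t * f x) ∂μ
      = exp (t * ∫ x, f x ∂μ) * mgf (fun x => f x - μ[f]) μ t := by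
    rw [mgf, ← integral_const_mul]
    refine integral_congr_ae (ae_of_all _ fun x => ?_)
    simp only
    rw [← exp_add]
    ring_nf
  rw [h2, exp_add]
  push_cast at h
  gcongr

lemma sum_mul_exp_mul_le {S : Type*} [Fintype S] {p f : S → ℝ} (hp : ∀ a, 0 ≤ p a)
    (hp1 : ∑ a, p a = 1) {R : ℝ≥0} (hR : ∀ a b, f a - f b ≤ R) (t : ℝ) :
    ∑ a, p a * exp (t * f a)
      ≤ exp (t * ∑ a, p a * f a + (R / 2 : ℝ) ^ 2 * t ^ 2 / 2) := by
  let _ : MeasurableSpace S := ⊤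
  let ν : Measure S := ∑ a, ENNReal.ofReal (p a) • Measure.dirac a
  have hν : IsProbabilityMeasure ν := ⟨by
    simp [ν, ← ENNReal.ofReal_sum_of_nonneg fun a _ => hp a, hp1]⟩
  have hint : ∀ g : S → ℝ, ∫ a, g a ∂ν = ∑ a, p a * g a := fun g => by
    rw [integral_finsetSum_measure fun a _ =>
      (integrable_dirac (by finiteness)).smul_measure ENNReal.ofReal_ne_top]
    simp [integral_smul_measure, ENNReal.toReal_ofReal (hp _)]
  have h := integral_exp_mul_le (μ := ν) (f := f) (measurable_of_finite f).aemeasurable hR t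
  rwa [hint, hint] at h

end Hoeffding

/-! ### Measurability of the functions involved. -/

section Measurability

variable {S : Type*} [MeasurableSpace S]

lemma measurable_shift : Measurable (shift : (ℕ → S) → ℕ → S) :=
  measurable_pi_lambda _ fun n => measurable_pi_apply (n + 1)

lemma measurable_cons (a : S) : Measurable (cons a) := by
  refine measurable_pi_lambda _ fun n => ?_
  cases n with
  | zero => exact measurable_const
  | succ n => exact measurable_pi_apply n

lemma measurable_birkhoffSum {φ : (ℕ → S) → ℝ} (hφ : Measurable φ) (n : ℕ) :
    Measurable (birkhoffSum shift φ n) := by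
  unfold birkhoffSum
  exact Finset.measurable_sum _ fun k _ => hφ.comp (measurable_shift.iterate k)

variable [Fintype S]

lemma measurable_transfer {φp f : (ℕ → S) → ℝ} (hφp : Measurable φp) (hf : Measurable f) :
    Measurable (transfer φp f) := by
  unfold transfer
  exact Finset.measurable_sum _ fun a _ =>
    ((hφp.comp (measurable_cons a)).exp).mul (hf.comp (measurable_cons a))

lemma measurable_transferSum {φp φ : (ℕ → S) → ℝ} (hφp : Measurable φp) (hφ : Measurable φ)
    (k : ℕ) : Measurable (transferSum φp φ k) := by
  induction k with
  | zero => exact measurable_const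
  | succ k ih => exact measurable_transfer hφp (hφ.add ih)

variable [DiscreteMeasurableSpace S] {θ L : ℝ} {φ : (ℕ → S) → ℝ}

lemma HasLipNorm.measurable (hφ : HasLipNorm θ L φ) (hθ : θ ∈ Set.Ioo (0 : ℝ) 1) :
    Measurable φ := by
  let _ : TopologicalSpace S := ⊥
  have : DiscreteTopology S := ⟨rfl⟩
  refine Continuous.measurable (continuous_iff_continuousAt.2 fun x => ?_)
  rw [Metric.continuousAt_iff']
  intro r hr
  have hlim : Filter.Tendsto (fun n : ℕ => L * θ ^ n) Filter.atTop (nhds 0) := by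
    simpa using (tendsto_pow_atTop_nhds_zero_of_lt_one hθ.1.le hθ.2).const_mul L
  obtain ⟨n, hn⟩ := (hlim.eventually_lt_const hr).exists
  have hev : ∀ᶠ y in nhds x, ∀ i ∈ Finset.range n, y i = x i :=
    (Finset.eventually_all _).2 fun i _ =>
      (continuous_apply i).continuousAt.eventually_mem ((isOpen_discrete {x i}).mem_nhds rfl)
  filter_upwards [hev] with y hy
  have hy' : ∀ i < n, y i = x i := fun i hi => hy i (Finset.mem_range.2 hi)
  rw [Real.dist_eq]
  refine lt_of_le_of_lt ?_ hn
  exact abs_sub_le_iff.2 ⟨hφ.sub_le_pow hθ hy', hφ.sub_le_pow hθ fun i hi => (hy' i hi).symm⟩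

end Measurability

/-! ### Uniform bounds and the pull-out property of the transfer operator. -/

section Boundedness

variable {S : Type*} {φ : (ℕ → S) → ℝ}

lemma abs_birkhoffSum_le {C : ℝ} (hφ : ∀ x, |φ x| ≤ C) (n : ℕ) (x : ℕ → S) :
    |birkhoffSum shift φ n x| ≤ n * C := by
  unfold birkhoffSum
  refine (Finset.abs_sum_le_sum_abs _ _).trans ?_
  refine (Finset.sum_le_card_nsmul _ _ C fun k _ => hφ _).trans ?_
  simp

variable [Fintype S] {φp : (ℕ → S) → ℝ}

lemma abs_transfer_le (hnorm : IsNormalized φp) {f : (ℕ → S) → ℝ} {C : ℝ}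
    (hf : ∀ x, |f x| ≤ C) (x : ℕ → S) : |transfer φp f x| ≤ C := by
  unfold transfer
  refine (Finset.abs_sum_le_sum_abs _ _).trans ?_
  calc ∑ a, |exp (φp (cons a x)) * f (cons a x)| ≤ ∑ a, exp (φp (cons a x)) * C :=
        Finset.sum_le_sum fun a _ => by
          rw [abs_mul, abs_exp]
          exact mul_le_mul_of_nonneg_left (hf _) (exp_pos _).le
    _ = C := by rw [← Finset.sum_mul, hnorm x, one_mul]

lemma abs_transferSum_le (hnorm : IsNormalized φp) {C : ℝ} (hφ : ∀ x, |φ x| ≤ C) (k : ℕ)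
    (x : ℕ → S) : |transferSum φp φ k x| ≤ k * C := by
  induction k generalizing x with
  | zero => simp [transferSum]
  | succ k ih =>
    refine abs_transfer_le hnorm (fun y => ?_) x
    simp only [Pi.add_apply]
    push_cast
    linarith [abs_add_le (φ y) (transferSum φp φ k y), hφ y, ih y]

lemma transfer_mul_comp_shift (f g : (ℕ → S) → ℝ) (x : ℕ → S) :
    transfer φp (fun y => f y * g (shift y)) x = transfer φp f x * g x := by
  simp only [transfer, Finset.sum_mul]
  exact Finset.sum_congr rfl fun a _ => by rw [show shift (cons a x) = x from rfl, mul_assoc]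

end Boundedness

/-! ### Sub-Gaussian concentration of Birkhoff sums. -/

section Concentration

variable {S : Type*} [Fintype S] [MeasurableSpace S]
  {θ L Lp : ℝ} {φ φp : (ℕ → S) → ℝ} {μ : Measure (ℕ → S)}

lemma integrable_of_abs_le {Ω : Type*} [MeasurableSpace Ω] {μ : Measure Ω} [IsFiniteMeasure μ]
    {f : Ω → ℝ} (hf : Measurable f) {C : ℝ} (hC : ∀ x, |f x| ≤ C) : Integrable f μ :=
  Integrable.of_bound hf.aestronglyMeasurable C (ae_of_all _ hC)

lemma integral_transferSum (hμ : IsEquilibriumState φp μ) (hnorm : IsNormalized φp)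
    (hφpm : Measurable φp) (hφm : Measurable φ) {C : ℝ} (hC : ∀ x, |φ x| ≤ C)
    (hmean : ∫ x, φ x ∂μ = 0) (k : ℕ) : ∫ x, transferSum φp φ k x ∂μ = 0 := by
  have := hμ.prob
  induction k with
  | zero => simp [transferSum]
  | succ k ih =>
    have hm := measurable_transferSum hφpm hφm k
    have hb := abs_transferSum_le hnorm hC k
    simp only [transferSum]
    rw [hμ.dual _ (hφm.add hm) ⟨C + k * C, fun x => (abs_add_le _ _).trans
      (add_le_add (hC x) (hb x))⟩]
    simp only [Pi.add_apply]
    rw [integral_add (integrable_of_abs_le hφm hC) (integrable_of_abs_le hm hb), hmean, ih,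
      add_zero]

/-- The correction `transferSum` is included so that the induction on `n` closes: one use of duality
replaces `(k, n + 1)` by `(k + 1, n)` at the cost of one Hoeffding factor. -/
lemma integral_exp_transferSum_add_birkhoffSum_le (hμ : IsEquilibriumState φp μ)
    (hnorm : IsNormalized φp) (hφpm : Measurable φp) (hφm : Measurable φ) {C : ℝ}
    (hC : ∀ x, |φ x| ≤ C) {R : ℝ≥0}
    (hR : ∀ k x y, (φ + transferSum φp φ k) x - (φ + transferSum φp φ k) y ≤ R)
    (t : ℝ) (n k : ℕ) :
    ∫ x, exp (t * transferSum φp φ k x + t * birkhoffSum shift φ n x) ∂μ ≤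
      exp (n * ((R / 2 : ℝ) ^ 2 * t ^ 2 / 2)) * ∫ x, exp (t * transferSum φp φ (k + n) x) ∂μ := by
  have := hμ.prob
  induction n generalizing k with
  | zero => simp
  | succ n ih =>
    have hm := fun k => measurable_transferSum hφpm hφm k
    have hb := fun k => abs_transferSum_le hnorm hC k
    have hSm := fun n => measurable_birkhoffSum hφm n
    have hSb := fun n => abs_birkhoffSum_le hC n
    have hbd : ∀ k n, ∃ K : ℝ, ∀ x,
        |exp (t * transferSum φp φ k x + t * birkhoffSum shift φ n x)| ≤ K := fun k n =>
      ⟨exp (|t| * (k * C) + |t| * (n * C)), fun x => by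
        rw [abs_exp, exp_le_exp]
        refine (le_abs_self _).trans ((abs_add_le _ _).trans ?_)
        rw [abs_mul, abs_mul]
        gcongr
        · exact hb k x
        · exact hSb n x⟩
    have hmeas : ∀ k n, Measurable fun x =>
        exp (t * transferSum φp φ k x + t * birkhoffSum shift φ n x) := fun k n =>
      (((hm k).const_mul t).add ((hSm n).const_mul t)).exp
    have hint : ∀ k n, Integrable (fun x =>
        exp (t * transferSum φp φ k x + t * birkhoffSum shift φ n x)) μ := fun k n =>
      let ⟨_, hK⟩ := hbd k n
      integrable_of_abs_le (hmeas k n) hK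
    have hfact : ∀ x, transfer φp
        (fun x => exp (t * transferSum φp φ k x + t * birkhoffSum shift φ (n + 1) x)) x =
        transfer φp (fun y => exp (t * (φ + transferSum φp φ k) y)) x *
          exp (t * birkhoffSum shift φ n x) := fun x => by
      rw [← transfer_mul_comp_shift _ (fun x => exp (t * birkhoffSum shift φ n x))]
      congr 1
      ext y
      rw [birkhoffSum_succ', Pi.add_apply, ← exp_add]
      ring_nf
    have hstep : ∀ x, transfer φp
        (fun x => exp (t * transferSum φp φ k x + t * birkhoffSum shift φ (n + 1) x)) x ≤
        exp ((R / 2 : ℝ) ^ 2 * t ^ 2 / 2) *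
          exp (t * transferSum φp φ (k + 1) x + t * birkhoffSum shift φ n x) := fun x => by
      rw [hfact, exp_add, ← mul_assoc]
      refine mul_le_mul_of_nonneg_right ?_ (exp_pos _).le
      have h := sum_mul_exp_mul_le (p := fun a => exp (φp (cons a x)))
        (f := fun a => (φ + transferSum φp φ k) (cons a x)) (fun a => (exp_pos _).le) (hnorm x)
        (fun a b => hR k _ _) t
      exact h.trans_eq (by rw [exp_add, mul_comm]; rfl)
    calc ∫ x, exp (t * transferSum φp φ k x + t * birkhoffSum shift φ (n + 1) x) ∂μ
        = ∫ x, transfer φp (fun x =>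
            exp (t * transferSum φp φ k x + t * birkhoffSum shift φ (n + 1) x)) x ∂μ :=
          (hμ.dual _ (hmeas _ _) (hbd _ _)).symm
      _ ≤ ∫ x, exp ((R / 2 : ℝ) ^ 2 * t ^ 2 / 2) *
            exp (t * transferSum φp φ (k + 1) x + t * birkhoffSum shift φ n x) ∂μ :=
          integral_mono_of_nonneg
            (ae_of_all _ fun x => Finset.sum_nonneg fun a _ => by positivity)
            ((hint _ _).const_mul _) (ae_of_all _ hstep)
      _ ≤ exp ((R / 2 : ℝ) ^ 2 * t ^ 2 / 2) *
            (exp (n * ((R / 2 : ℝ) ^ 2 * t ^ 2 / 2)) *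
              ∫ x, exp (t * transferSum φp φ (k + 1 + n) x) ∂μ) := by
          rw [integral_const_mul]
          exact mul_le_mul_of_nonneg_left (ih (k + 1)) (exp_pos _).le
      _ = _ := by
          rw [← mul_assoc, ← exp_add, add_assoc k 1 n, add_comm 1 n]
          push_cast
          ring_nf

lemma hasSubgaussianMGF_birkhoffSum (hμ : IsEquilibriumState φp μ)
    (hnorm : IsNormalized φp) (hφpm : Measurable φp) (hφm : Measurable φ) {C : ℝ}
    (hC : ∀ x, |φ x| ≤ C) (hmean : ∫ x, φ x ∂μ = 0) {R : ℝ≥0}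
    (hR : ∀ k x y, transferSum φp φ k x - transferSum φp φ k y ≤ R ∧
      (φ + transferSum φp φ k) x - (φ + transferSum φp φ k) y ≤ R) (n : ℕ) :
    HasSubgaussianMGF (birkhoffSum shift φ n) ((n + 1) * (R / 2) ^ 2) μ where
  integrable_exp_mul t := by
    have := hμ.prob
    refine integrable_of_abs_le ((measurable_birkhoffSum hφm n).const_mul t).exp
      (C := exp (|t| * (n * C))) fun x => ?_
    rw [abs_exp, exp_le_exp]
    refine (le_abs_self _).trans ?_
    rw [abs_mul]
    gcongr
    exact abs_birkhoffSum_le hC n x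
  mgf_le t := by
    have := hμ.prob
    -- With `k = 0` the correction on the left vanishes; the one left on the right costs a further
    -- Hoeffding factor, whence `n + 1`.
    have h := integral_exp_transferSum_add_birkhoffSum_le hμ hnorm hφpm hφm hC
      (fun k x y => (hR k x y).2) t n 0
    have h2 := integral_exp_mul_le (μ := μ)
      (measurable_transferSum hφpm hφm (0 + n)).aemeasurable (fun x y => (hR _ x y).1) t
    rw [integral_transferSum hμ hnorm hφpm hφm hC hmean, mul_zero, zero_add] at h2
    simp only [transferSum, Pi.zero_apply, mul_zero, zero_add] at h h2
    refine (h.trans (mul_le_mul_of_nonneg_left h2 (exp_pos _).le)).trans (le_of_eq ?_)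
    rw [← exp_add]
    push_cast
    ring_nf

variable [DiscreteMeasurableSpace S]

lemma measure_abs_birkhoffSum_ge_le (hμ : IsEquilibriumState φp μ)
    (hφp : HasLipNorm θ Lp φp) (hnorm : IsNormalized φp)
    (hφ : HasLipNorm θ L φ) (hθ : θ ∈ Set.Ioo (0 : ℝ) 1) (hmean : ∫ x, φ x ∂μ = 0)
    (n : ℕ) {r : ℝ} (hr : 0 ≤ r) :
    μ.real {x | r ≤ |birkhoffSum shift φ n x|} ≤
      2 * exp (-(2 * r ^ 2 / ((n + 1) * oscBound θ L Lp ^ 2))) := by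
  have := hμ.prob
  have hR0 : 0 ≤ oscBound θ L Lp :=
    (oscGain_nonneg hθ (zero_le_one.trans hφ.one_le) 0).trans
      (oscGain_le hθ (zero_le_one.trans hφ.one_le) (zero_le_one.trans hφp.one_le) 0)
  obtain ⟨R, hR⟩ : ∃ R : ℝ≥0, (R : ℝ) = oscBound θ L Lp := ⟨⟨_, hR0⟩, rfl⟩
  rw [← hR]
  have hsub := hasSubgaussianMGF_birkhoffSum hμ hnorm (hφp.measurable hθ) (hφ.measurable hθ)
    hφ.abs_le hmean (R := R) (hR ▸ transferSum_osc hφp hnorm hφ hθ) n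
  have h1 := hsub.measure_ge_le hr
  have h2 := hsub.neg.measure_ge_le hr
  have hE : -r ^ 2 / (2 * (((n + 1) * (R / 2) ^ 2 : ℝ≥0) : ℝ)) =
      -(2 * r ^ 2 / ((n + 1) * (R : ℝ) ^ 2)) := by
    push_cast
    field_simp
  rw [hE] at h1 h2
  have hset : {x | r ≤ |birkhoffSum shift φ n x|} ⊆
      {x | r ≤ birkhoffSum shift φ n x} ∪ {x | r ≤ (-birkhoffSum shift φ n) x} :=
    fun x (hx : r ≤ |_|) => le_abs.1 hx
  refine (measureReal_mono hset).trans ((measureReal_union_le _ _).trans ?_)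
  linarith

end Concentration

end MarkovShift

namespace MarkovShift

/-! ### Pathwise bound and expectation of the threshold. -/

section Threshold

variable {S : Type*} {φ : (ℕ → S) → ℝ} {δ : ℝ}

/-- The set `{|S_n| ≥ n ^ (1/2 + δ)}`. -/
def deviationSet (φ : (ℕ → S) → ℝ) (δ : ℝ) (n : ℕ) : Set (ℕ → S) :=
  {y | (n : ℝ) ^ (1 / 2 + δ) ≤ |birkhoffSum shift φ n y|}

lemma threshold_eq (x : ℕ → S) : threshold φ δ x =
    ∑' N : ℕ, Set.indicator (⋃ n ≥ N, deviationSet φ δ n) (fun _ => (1 : ℝ≥0∞)) x := rfl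

/-- Ensures that `threshold φ δ x ≤ n` forces `n ≠ 0`, so that division by `n` is legitimate. -/
lemma mem_deviationSet_zero (hδ : 0 < δ) (x : ℕ → S) : x ∈ deviationSet φ δ 0 := by
  simp [deviationSet, zero_rpow (by positivity : (2 : ℝ)⁻¹ + δ ≠ 0)]

/-- A deviation at time `n` switches on the indicators for `N = 0, …, n`, so the threshold is at
least `n + 1`. -/
lemma notMem_deviationSet_of_threshold_le {x : ℕ → S} {n : ℕ}
    (h : threshold φ δ x ≤ n) : x ∉ deviationSet φ δ n := fun hx => by
  have h1 : ((n + 1 : ℕ) : ℝ≥0∞) ≤ threshold φ δ x := by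
    rw [threshold_eq]
    refine le_trans (le_of_eq ?_) (ENNReal.sum_le_tsum (Finset.range (n + 1)))
    rw [Finset.sum_congr rfl fun N hN => Set.indicator_of_mem
      (Set.mem_iUnion₂.2 ⟨n, Finset.mem_range_succ_iff.1 hN, hx⟩) _]
    simp
  have h2 := h1.trans h
  rw [Nat.cast_le] at h2
  omega

lemma abs_birkhoffSum_div_le_of_threshold_le (hδ : 0 < δ) {x : ℕ → S} {n : ℕ}
    (h : threshold φ δ x ≤ n) :
    |birkhoffSum shift φ n x / n| ≤ (n : ℝ) ^ (-(1 / 2 - δ)) := by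
  have hx := notMem_deviationSet_of_threshold_le h
  have hn : n ≠ 0 := by
    rintro rfl
    exact hx (mem_deviationSet_zero hδ x)
  have hn0 : (0 : ℝ) < n := by positivity
  rw [abs_div, abs_of_pos hn0, div_le_iff₀ hn0]
  rw [← rpow_add_one hn0.ne']
  have hx' : |birkhoffSum shift φ n x| < (n : ℝ) ^ (1 / 2 + δ) := not_le.1 hx
  convert hx'.le using 2
  ring

variable [MeasurableSpace S]

lemma measurableSet_deviationSet (hφ : Measurable φ) (n : ℕ) :
    MeasurableSet (deviationSet φ δ n) :=
  measurableSet_le measurable_const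
    (continuous_abs.measurable.comp (measurable_birkhoffSum hφ n))

lemma measurableSet_iUnion_deviationSet (hφ : Measurable φ) (N : ℕ) :
    MeasurableSet (⋃ n ≥ N, deviationSet φ δ n) :=
  .iUnion fun n => .iUnion fun _ => measurableSet_deviationSet hφ n

lemma measurable_threshold (hφ : Measurable φ) : Measurable (threshold φ δ) := by
  change Measurable fun x => threshold φ δ x
  simp only [threshold_eq]
  exact Measurable.tsum fun N =>
    measurable_const.indicator (measurableSet_iUnion_deviationSet hφ N)

/-- The term `N = 0` costs at most `1`; in the others, the union bound and an exchange of sums count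
each `n` once for every index below it. -/
lemma lintegral_threshold_le {μ : Measure (ℕ → S)} [IsProbabilityMeasure μ]
    (hφ : Measurable φ) :
    ∫⁻ x, threshold φ δ x ∂μ ≤ 1 + ∑' n : ℕ, (n : ℝ≥0∞) * μ (deviationSet φ δ n) := by
  simp only [threshold_eq]
  rw [lintegral_tsum fun N =>
    (measurable_const.indicator (measurableSet_iUnion_deviationSet hφ N)).aemeasurable]
  simp only [lintegral_indicator_const (measurableSet_iUnion_deviationSet hφ _), one_mul]
  rw [tsum_eq_zero_add' ENNReal.summable]
  refine add_le_add prob_le_one ?_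
  have h1 : ∀ N : ℕ, μ (⋃ n ≥ N + 1, deviationSet φ δ n) ≤
      ∑' n : ℕ, if N < n then μ (deviationSet φ δ n) else 0 := fun N => by
    refine (measure_iUnion_le _).trans (ENNReal.tsum_le_tsum fun n => ?_)
    split_ifs with h
    · exact measure_mono (Set.iUnion_subset fun _ => subset_rfl)
    · simp [show ¬ n ≥ N + 1 from h]
  refine (ENNReal.tsum_le_tsum h1).trans ?_
  rw [ENNReal.tsum_comm]
  refine ENNReal.tsum_le_tsum fun n => ?_
  rw [tsum_eq_sum (s := Finset.range n) fun N hN => if_neg (by simpa using hN),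
    Finset.sum_congr rfl fun N hN => if_pos (Finset.mem_range.1 hN)]
  simp

end Threshold

/-! ### Convergence of the series. -/

section Series

lemma summable_mul_exp_neg_mul_rpow {c s : ℝ} (hc : 0 < c) (hs : 0 < s) :
    Summable fun n : ℕ => (n : ℝ) * exp (-(c * (n : ℝ) ^ s)) := by
  -- The exponent `-3 / s`, evaluated at `n ^ s`, gives `n ^ (-3)`, so the terms are `O(n ^ (-2))`.
  have h1 := (isLittleO_exp_neg_mul_rpow_atTop hc (-3 / s)).isBigO.comp_tendsto
    ((tendsto_rpow_atTop hs).comp tendsto_natCast_atTop_atTop)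
  have h2 := (Asymptotics.isBigO_refl (fun n : ℕ => (n : ℝ)) Filter.atTop).mul h1
  refine summable_of_isBigO_nat (Real.summable_nat_rpow.2 (by norm_num : (-2 : ℝ) < -1)) ?_
  refine (h2.congr' (Filter.Eventually.of_forall fun n => ?_) ?_)
  · simp
  · filter_upwards [Filter.eventually_gt_atTop 0] with n hn
    have hn0 : (0 : ℝ) < n := by positivity
    simp only [Function.comp_apply]
    rw [← rpow_mul hn0.le, mul_div_cancel₀ _ hs.ne']
    nth_rewrite 1 [← rpow_one (n : ℝ)]
    rw [← rpow_add hn0]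
    norm_num

end Series

/-! ### Comparison with the constants of the statement. -/

section Constants

variable {θ L Lp ε z₀ : ℝ}

/-- The three factors are at most `1 - θ`, `exp (-(Lp / (1 - θ)))` and `1`; the first two cancel
those of `oscBound`, leaving `L`. -/
lemma rate_mul_oscBound_le (hθ : θ ∈ Set.Ioo (0 : ℝ) 1) (hL : 0 ≤ L) (hε : 0 ≤ ε)
    (hεa : ε ≤ 1 - aConst θ Lp) (hz1 : 1 ≤ z₀) (hzθ : z₀ ≤ 1 / θ) (hz2 : z₀ ≤ exp 2) :
    (1 - z₀ ^ (-(1 / 2) : ℝ)) * (1 - aConst θ Lp - ε) * log √z₀ * oscBound θ L Lp ≤ L := by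
  have hz0 : 0 < z₀ := zero_lt_one.trans_le hz1
  have h1θ : 0 < 1 - θ := sub_pos.2 hθ.2
  have h1 : θ ≤ z₀ ^ (-(1 / 2) : ℝ) := by
    calc θ ≤ z₀⁻¹ := by
          rw [le_inv_comm₀ hθ.1 hz0, ← one_div]
          exact hzθ
      _ = z₀ ^ (-1 : ℝ) := (rpow_neg_one z₀).symm
      _ ≤ _ := rpow_le_rpow_of_exponent_le hz1 (by norm_num)
  have h2 : z₀ ^ (-(1 / 2) : ℝ) ≤ 1 := rpow_le_one_of_one_le_of_nonpos hz1 (by norm_num)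
  have h3 : log √z₀ ≤ 1 := by
    rw [log_sqrt hz0.le]
    linarith [(log_le_iff_le_exp hz0).2 hz2]
  have h4 : 0 ≤ log √z₀ := log_nonneg (one_le_sqrt.2 hz1)
  have h5 : 1 - aConst θ Lp = exp (-(Lp / (1 - θ))) := by
    simp [aConst, div_eq_mul_inv]
  have hR : 0 ≤ oscBound θ L Lp := by
    unfold oscBound
    positivity
  calc (1 - z₀ ^ (-(1 / 2) : ℝ)) * (1 - aConst θ Lp - ε) * log √z₀ * oscBound θ L Lp
      ≤ (1 - θ) * exp (-(Lp / (1 - θ))) * 1 * oscBound θ L Lp := by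
        gcongr
        · rw [← h5]
          exact sub_le_self _ hε
    _ = L * (exp (-(Lp / (1 - θ))) * exp (Lp / (1 - θ))) := by
        unfold oscBound
        field_simp
    _ = L := by rw [← exp_add, neg_add_cancel, exp_zero, mul_one]

lemma le_oscBound (hθ : θ ∈ Set.Ioo (0 : ℝ) 1) (hL : 0 ≤ L) (hLp : 0 ≤ Lp) :
    L ≤ oscBound θ L Lp := by
  have h1θ : 0 < 1 - θ := sub_pos.2 hθ.2
  have h1 : L ≤ L / (1 - θ) := le_div_self hL h1θ (sub_le_self _ hθ.1.le)
  exact h1.trans (le_mul_of_one_le_right (hL.trans h1) (one_le_exp (by positivity)))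

/-- The extra `1` from the `N = 0` term is absorbed at `n = 2`: there the left side is at most `3`,
while the right side is at least `4 (1 - 1 / 36)`. For other `n ≥ 1`, `n + 1 ≤ 2 n` and `c R ^ 2 ≤
1` suffice. -/
lemma mul_add_ite_le {R c q δ : ℝ} (hR : 0 < R) (hc : c ≤ 1 / 72)
    (hcR : c * R ^ 2 ≤ 1) (hδ2 : δ < 1 / 2) {n : ℕ} (hq1 : q ≤ 1)
    (hq : q ≤ 2 * exp (-(2 * ((n : ℝ) ^ (1 / 2 + δ)) ^ 2 / ((n + 1) * R ^ 2)))) :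
    n * q + (if n = 2 then 1 else 0) ≤ 2 * (n * exp (-(c * (n : ℝ) ^ (2 * δ)))) := by
  split_ifs with h2
  · subst h2
    push_cast
    have h3 : (2 : ℝ) ^ (2 * δ) ≤ 2 := by
      calc (2 : ℝ) ^ (2 * δ) ≤ 2 ^ (1 : ℝ) :=
            rpow_le_rpow_of_exponent_le one_le_two (by linarith)
        _ = 2 := rpow_one 2
    have h4 : c * (2 : ℝ) ^ (2 * δ) ≤ 1 / 72 * 2 := by gcongr
    have h5 := add_one_le_exp (-(c * (2 : ℝ) ^ (2 * δ)))
    linarith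
  · rw [add_zero]
    rcases Nat.eq_zero_or_pos n with rfl | hn
    · simp
    have hn1 : (1 : ℝ) ≤ n := by exact_mod_cast hn
    have hn0 : (0 : ℝ) < n := by positivity
    have h3 : ((n : ℝ) ^ (1 / 2 + δ)) ^ 2 = n * (n : ℝ) ^ (2 * δ) := by
      rw [← rpow_natCast, ← rpow_mul hn0.le]
      nth_rewrite 2 [← rpow_one (n : ℝ)]
      rw [← rpow_add hn0]
      congr 1
      push_cast
      ring
    have h4 : c * (n : ℝ) ^ (2 * δ) ≤
        2 * ((n : ℝ) ^ (1 / 2 + δ)) ^ 2 / ((n + 1) * R ^ 2) := by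
      rw [h3, le_div_iff₀ (by positivity)]
      calc c * (n : ℝ) ^ (2 * δ) * ((n + 1) * R ^ 2)
          = c * R ^ 2 * ((n + 1) * (n : ℝ) ^ (2 * δ)) := by ring
        _ ≤ 1 * ((2 * n) * (n : ℝ) ^ (2 * δ)) := by
          gcongr
          linarith
        _ = _ := by ring
    calc n * q ≤ n * (2 * exp (-(c * (n : ℝ) ^ (2 * δ)))) := by
          gcongr
          exact hq.trans (by gcongr)
      _ = _ := by ring

end Constants

/-! ### Assembly of the expectation bound. -/

section Threshold

variable {S : Type*} {φ : (ℕ → S) → ℝ} {δ : ℝ} [MeasurableSpace S]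

lemma lintegral_threshold_le_ofReal_tsum {μ : Measure (ℕ → S)} [IsProbabilityMeasure μ]
    (hφ : Measurable φ) {c R : ℝ} (hR : 0 < R) (hc0 : 0 < c) (hc : c ≤ 1 / 72)
    (hcR : c * R ^ 2 ≤ 1) (hδ : δ ∈ Set.Ioo (0 : ℝ) (1 / 2))
    (htail : ∀ n : ℕ, μ.real (deviationSet φ δ n) ≤
      2 * exp (-(2 * ((n : ℝ) ^ (1 / 2 + δ)) ^ 2 / ((n + 1) * R ^ 2)))) :
    ∫⁻ x, threshold φ δ x ∂μ ≤
      ENNReal.ofReal (2 * ∑' n : ℕ, (n : ℝ) * exp (-(c * (n : ℝ) ^ (2 * δ)))) := by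
  have hsum := (summable_mul_exp_neg_mul_rpow hc0 (mul_pos two_pos hδ.1)).mul_left 2
  rw [← tsum_mul_left, ENNReal.ofReal_tsum_of_nonneg (fun n => by positivity) hsum]
  refine (lintegral_threshold_le hφ).trans ?_
  have h1 : (1 : ℝ≥0∞) = ∑' n : ℕ, if n = 2 then 1 else 0 := (tsum_ite_eq 2 fun _ => 1).symm
  rw [h1, add_comm, ← ENNReal.tsum_add]
  refine ENNReal.tsum_le_tsum fun n => ?_
  refine le_trans (le_of_eq ?_) (ENNReal.ofReal_le_ofReal
    (mul_add_ite_le hR hc hcR hδ.2 measureReal_le_one (htail n)))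
  rw [ENNReal.ofReal_add (by positivity) (by positivity), ENNReal.ofReal_mul (by positivity),
    ENNReal.ofReal_natCast, ofReal_measureReal]
  split_ifs <;> simp

end Threshold

end MarkovShift

end

theorem theorem4 {S : Type*} [Fintype S] [MeasurableSpace S] [DiscreteMeasurableSpace S]
    (θ : ℝ) (hθ : θ ∈ Set.Ioo (0 : ℝ) 1)
    (φp : (ℕ → S) → ℝ) (Lp : ℝ) (hφp : MarkovShift.HasLipNorm θ Lp φp)
    (hnorm : MarkovShift.IsNormalized φp)
    (μ : Measure (ℕ → S)) (hμ : MarkovShift.IsEquilibriumState φp μ)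
    (φ : (ℕ → S) → ℝ) (L : ℝ) (hφ : MarkovShift.HasLipNorm θ L φ)
    (hmean : ∫ x, φ x ∂μ = 0)
    (a ε U z₀ : ℝ) (ha : a = MarkovShift.aConst θ Lp)
    (hε : ε ∈ Set.Ioo 0 (min (1 - a) (1 - θ)))
    (hU : U = MarkovShift.uConst θ Lp ε)
    (hz₀ : z₀ ∈ Set.Ioo 1
      (min (min (((a + ε / 2) / a) ^ U) ((θ + ε) / θ)) (min ((1 - ε) / θ) (exp 2))))
    (δ : ℝ) (hδ : δ ∈ Set.Ioo (0 : ℝ) (1 / 2)) :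
    (∀ᵐ x ∂μ, MarkovShift.threshold φ δ x < ∞ ∧
      ∀ n : ℕ, MarkovShift.threshold φ δ x ≤ (n : ℝ≥0∞) →
        |birkhoffSum MarkovShift.shift φ n x / n| ≤ (n : ℝ) ^ (-(1 / 2 - δ))) ∧
    Measurable (MarkovShift.threshold φ δ) ∧
    Summable (fun m : ℕ+ => (m : ℝ) * exp (-((m : ℝ) ^ (2 * δ) *
      (1 - z₀ ^ (-(1 / 2) : ℝ)) ^ 2 * (1 - a - ε) ^ 2 * (log √z₀) ^ 2 / (72 * L ^ 2)))) ∧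
    ∫⁻ x, MarkovShift.threshold φ δ x ∂μ ≤ ENNReal.ofReal
      (2 * exp ((1 - z₀ ^ (-(1 / 2) : ℝ)) * (1 - a - ε) * log √z₀ /
          (36 * L * z₀ ^ (1 / 2 : ℝ))) *
        ∑' m : ℕ+, (m : ℝ) * exp (-((m : ℝ) ^ (2 * δ) *
          (1 - z₀ ^ (-(1 / 2) : ℝ)) ^ 2 * (1 - a - ε) ^ 2 * (log √z₀) ^ 2 / (72 * L ^ 2)))) := by
  have hprob := hμ.prob
  have hφm := hφ.measurable hθ
  have hL : 0 < L := zero_lt_one.trans_le hφ.one_le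
  have hLp : 0 < Lp := zero_lt_one.trans_le hφp.one_le
  subst ha
  have hε1 : ε < 1 - MarkovShift.aConst θ Lp := hε.2.trans_le (min_le_left _ _)
  have hz1 : 1 < z₀ := hz₀.1
  have hzθ : z₀ ≤ 1 / θ := by
    refine (hz₀.2.trans_le ((min_le_right _ _).trans (min_le_left _ _))).le.trans ?_
    have := hε.1
    have := hθ.1
    gcongr
    linarith
  have hz2 : z₀ ≤ exp 2 := (hz₀.2.trans_le ((min_le_right _ _).trans (min_le_right _ _))).le
  set κ := (1 - z₀ ^ (-(1 / 2) : ℝ)) * (1 - MarkovShift.aConst θ Lp - ε) * log √z₀ with hκ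
  set R := MarkovShift.oscBound θ L Lp with hRdef
  have hLR : L ≤ R := MarkovShift.le_oscBound hθ hL.le hLp.le
  have hR : 0 < R := hL.trans_le hLR
  have hκ0 : 0 < κ := mul_pos (mul_pos
    (sub_pos.2 (rpow_lt_one_of_one_lt_of_neg hz1 (by norm_num))) (sub_pos.2 hε1))
    (log_pos (lt_sqrt_of_sq_lt (by simpa using hz1)))
  have hκR : κ * R ≤ L :=
    MarkovShift.rate_mul_oscBound_le hθ hL.le hε.1.le hε1.le hz1.le hzθ hz2
  -- Follows from `κ R ≤ L ≤ R`.
  have hκ1 : κ ≤ 1 := by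
    by_contra! h
    nlinarith
  set c := κ ^ 2 / (72 * L ^ 2) with hcdef
  have hc0 : 0 < c := by positivity
  have hc : c ≤ 1 / 72 := by
    have h1 : κ ^ 2 ≤ 1 := pow_le_one₀ hκ0.le hκ1
    have h2 : 1 ≤ L ^ 2 := one_le_pow₀ hφ.one_le
    rw [hcdef]
    gcongr
    linarith
  have hcR : c * R ^ 2 ≤ 1 := by
    have h1 : (κ * R) ^ 2 ≤ L ^ 2 := by gcongr
    rw [hcdef, div_mul_eq_mul_div, div_le_one (by positivity)]
    nlinarith [sq_nonneg L]
  have hterm : ∀ m : ℝ, m ^ (2 * δ) * (1 - z₀ ^ (-(1 / 2) : ℝ)) ^ 2 *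
      (1 - MarkovShift.aConst θ Lp - ε) ^ 2 * (log √z₀) ^ 2 / (72 * L ^ 2) =
      c * m ^ (2 * δ) := fun m => by
    rw [hcdef, hκ]
    ring
  simp only [hterm]
  have hsum := MarkovShift.summable_mul_exp_neg_mul_rpow hc0 (mul_pos two_pos hδ.1)
  have hmain := MarkovShift.lintegral_threshold_le_ofReal_tsum hφm hR hc0 hc hcR hδ fun n =>
    MarkovShift.measure_abs_birkhoffSum_ge_le hμ hφp hnorm hφ hθ hmean n (by positivity)
  have hmeas := MarkovShift.measurable_threshold (δ := δ) hφm
  refine ⟨?_, hmeas, hsum.comp_injective PNat.coe_injective, hmain.trans ?_⟩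
  · filter_upwards [ae_lt_top hmeas (ne_top_of_le_ne_top ENNReal.ofReal_ne_top hmain)] with x hx
    exact ⟨hx, fun n hn => MarkovShift.abs_birkhoffSum_div_le_of_threshold_le hδ.1 hn⟩
  · rw [tsum_pnat_eq_tsum_of_eq_zero (f := fun n : ℕ => (n : ℝ) * exp (-(c * (n : ℝ) ^ (2 * δ)))) (by simp)]
    refine ENNReal.ofReal_le_ofReal (mul_le_mul_of_nonneg_right ?_
      (tsum_nonneg fun n => by positivity))
    -- The exponential prefactor is at least `1`, so the constant `2` already suffices.
    exact le_mul_of_one_le_right two_pos.le (one_le_exp (by positivity))
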